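/- Let $X=\mathbb Z\omega\oplus\mathbb Z\delta$ be the character lattice of $T\times S^1$, where $T\subset SU(2)$ is the maximal torus with fundamental character $\omega$ and $\delta$ is the basic character of $S^1$. Let $\alpha_1=2\omega$ and $\alpha_0=\delta-\alpha_1$ be the simple roots of affine $\mathfrak{sl}_2$, and let $\overline W=\langle s_0,s_1\rangle$ be the affine Weyl group, acting on $X$ by $s_1\omega=-\omega$, $s_0\omega=\delta-\omega$, $s_i\delta=\delta$. Let $W=\langle s_1\rangle$ be the finite Weyl group. Let $Q$ be the fraction field of $\mathbb Z[X]$, with the involution $\overline{e^{\lambda}}=e^{-\lambda}$, and let $Q_{\overline W}=\bigoplus_{w\in\overline W}Q\,\delta_w$ be the ring with product $(q\,\delta_v)(q'\,\delta_w)=q\,(v q')\,\delta_{vw}$. Put $T_{s_i}=\frac{1}{1-e^{\alpha_i}}\delta_{s_i}+\frac{1}{1-e^{-\alpha_i}}\delta_e$, and for a reduced word $w=s_{i_1}\cdots s_{i_n}$ write $T_w=T_{s_{i_1}}\cdots T_{s_{i_n}}=\sum_v b_{w,v}\,\delta_v$. The $(T\times S^1)$-fixed points of $\Omega SU(2)$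 are indexed by the cosets $w_mW$, $m\ge 0$, where $w_0=e$, $w_1=s_0$, $w_2=s_1s_0$, $w_3=s_0s_1s_0$, and so on. The rational function attached to the fixed point $w_m$ in the localization formula of the Schubert variety $X_n=X_{w_n}$ is $$R_m(X_n)=\sum_{v\in w_mW}\overline{b_{w_n,v}}\in Q .$$ The function $R_m(\Omega SU(2))$ attached to $w_m$ in the localization formula of $\Omega SU(2)$ is the limit of $R_m(X_n)$ as $n\to\infty$. Here each $R_m(X_n)$ is expanded in the ring of formal sums $\sum_\lambda n_\lambda e^\lambda$ ($n_\lambda\in\mathbb Z$) whose support lies in a finite union of cones $\lambda_i+\mathbb N\alpha_0+\mathbb N\alpha_1$ ($\mathbb N\ni 0$), and convergence is coefficientwise. **Theorem.** For every $m\ge 0$ the expansions and the limit $R_m(\Omega SU(2))$ exist, the infinite sum and the infinite product below converge in this ring of formal sums, the product is invertible there, and $$R_m(\Omega SU(2))=\frac{(-1)^m\,e^{f(w_m)}\,\bigl(1-e^{w_m\cdot\alpha_1}\bigr)\,\sum_{n=0}^{\infty}P(n)\,e^{n\delta}}{\prod_{\alpha\in\triangle^+_{re}}\bigl(1-e^{\alpha}\bigr)}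 .$$ Here $f(w)=\sum_{j=1}^{k}s_{i_1}\cdots s_{i_{j-1}}(\alpha_{i_j})$ for a reduced word $w=s_{i_1}\cdots s_{i_k}$, $P(n)$ is the number of partitions of $n$, and $\triangle^+_{re}=\{\alpha_1\}\cup\{\pm\alpha_1+n\delta\mid n\ge 1\}$ is the set of positive real roots of affine $\mathfrak{sl}_2$. -/

import Mathlib

open Filter Topology

/-!
Localization data of the affine Grassmannian `ΩSU(2)` of `SU(2)` under `T × S¹`:
characters, affine Weyl group, nil-Hecke ring, and the formal completion in which the
limit of the rational functions of the Schubert varieties is taken.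
-/

namespace AffineSL2

noncomputable section

/-- The character lattice `X = ℤω ⊕ ℤδ` of `T × S¹`, where `T` is the maximal torus of `SU(2)`,
`ω` is its fundamental character and `δ` is the basic character of `S¹`.
The pair `(a, d)` stands for `a ω + d δ`. -/
def CharLattice : Type := ℤ × ℤ

instance : AddCommGroup CharLattice := inferInstanceAs (AddCommGroup (ℤ × ℤ))

instance : UniqueSums CharLattice := inferInstanceAs (UniqueSums (ℤ × ℤ))

/-- The smallest positive imaginary root `δ`. -/
def delta : CharLattice := ((0, 1) : ℤ × ℤ)

/-- The simple roots of affine `sl₂`: `α₁ = 2ω` and `α₀ = δ - 2ω`. -/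
def simpleRoot (i : Fin 2) : CharLattice := if i = 0 then ((-2, 1) : ℤ × ℤ) else ((2, 0) : ℤ × ℤ)

/-- The pairing with the simple coroots: `⟨ω, α₁^∨⟩ = 1`, `⟨ω, α₀^∨⟩ = -1`, `⟨δ, αᵢ^∨⟩ = 0`. -/
def simpleCoroot (i : Fin 2) : CharLattice →ₗ[ℤ] ℤ :=
  if i = 0 then -(LinearMap.fst ℤ ℤ ℤ : ℤ × ℤ →ₗ[ℤ] ℤ) else (LinearMap.fst ℤ ℤ ℤ : ℤ × ℤ →ₗ[ℤ] ℤ)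

theorem simpleCoroot_simpleRoot (i : Fin 2) : simpleCoroot i (simpleRoot i) = 2 := by
  fin_cases i
  · exact (by norm_num : -(-2 : ℤ) = 2)
  · exact (rfl : (2 : ℤ) = 2)

/-- `δ = α₀ + α₁`. -/
theorem delta_eq : delta = simpleRoot 0 + simpleRoot 1 := rfl

/-- The simple reflection `sᵢ(λ) = λ - ⟨λ, αᵢ^∨⟩ αᵢ`. -/
def reflection (i : Fin 2) : CharLattice ≃ₗ[ℤ] CharLattice := Module.reflection (simpleCoroot_simpleRoot i)

/-- The affine Weyl group, generated by the two simple reflections. -/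
abbrev Weyl : Type := Subgroup.closure (Set.range reflection)

/-- The simple reflection `sᵢ` as an element of the affine Weyl group. -/
def s (i : Fin 2) : Weyl := ⟨reflection i, Subgroup.subset_closure ⟨i, rfl⟩⟩

/-- The finite Weyl group `W`, generated by `s₁`. -/
def finiteWeyl : Subgroup Weyl := Subgroup.closure {s 1}

/-- The product in the affine Weyl group of a word in the simple reflections. -/
def weylOfWord (l : List (Fin 2)) : Weyl := (l.map s).prod

/-! ### Rational functions on the torus and the nil-Hecke ring -/

/-- The group ring of the character lattice. -/
abbrev CharRing : Type := AddMonoidAlgebra ℤ CharLattice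

/-- The field of rational functions on `T × S¹`: the fraction field of the group ring. -/
abbrev RatFun : Type := FractionRing CharRing

/-- The exponential `e^λ` as a rational function. -/
def expRat (a : CharLattice) : RatFun := algebraMap CharRing RatFun (AddMonoidAlgebra.single a 1)

/-- An automorphism of the lattice acts on rational functions by `e^λ ↦ e^{g λ}`. -/
def ratFunAut : (CharLattice ≃ₗ[ℤ] CharLattice) →* RingAut RatFun where
  toFun g := IsFractionRing.ringEquivOfRingEquiv
    (AddMonoidAlgebra.domCongr ℤ ℤ g.toAddEquiv).toRingEquiv
  map_one' := by
    have h : (AddMonoidAlgebra.domCongr ℤ ℤ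
        (1 : CharLattice ≃ₗ[ℤ] CharLattice).toAddEquiv).toRingEquiv = RingEquiv.refl CharRing :=
      RingEquiv.ext fun x => AddMonoidAlgebra.ext (Finsupp.ext fun _ => by simp; rfl)
    rw [h]
    exact IsFractionRing.ringEquivOfRingEquiv_refl
  map_mul' g h := by
    refine RingEquiv.ext fun x => ?_
    obtain ⟨p, q, hq, rfl⟩ := IsFractionRing.div_surjective (A := CharRing) x
    have key : ∀ p : CharRing, AddMonoidAlgebra.domCongr ℤ ℤ (g * h).toAddEquiv p =
        AddMonoidAlgebra.domCongr ℤ ℤ g.toAddEquiv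
          (AddMonoidAlgebra.domCongr ℤ ℤ h.toAddEquiv p) := fun p =>
      AddMonoidAlgebra.ext (Finsupp.ext fun _ => by simp; rfl)
    simp [map_div₀, RingAut.mul_apply, key]

instance : MulSemiringAction Weyl RatFun :=
  MulSemiringAction.compHom RatFun (ratFunAut.comp (Subgroup.subtype _))

theorem smul_expRat (w : Weyl) (a : CharLattice) : w • expRat a = expRat (w.1 a) := by
  change IsFractionRing.ringEquivOfRingEquiv _ (algebraMap CharRing RatFun _) = _
  rw [IsFractionRing.ringEquivOfRingEquiv_algebraMap]
  simp [expRat]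

/-- The involution of the field of rational functions with `e^λ ↦ e^{-λ}`. -/
def bar : RatFun ≃+* RatFun := ratFunAut (LinearEquiv.neg ℤ)

/-- The ring `⊕_w Q δ_w` with the multiplication `(q δ_v)(q' δ_w) = q (v q') δ_{vw}`. -/
abbrev NilHecke : Type := SkewMonoidAlgebra RatFun Weyl

/-- `T_{sᵢ} = (1 - e^{αᵢ})⁻¹ δ_{sᵢ} + (1 - e^{-αᵢ})⁻¹ δ_e`. -/
def nilT (i : Fin 2) : NilHecke :=
  SkewMonoidAlgebra.single (s i) (1 - expRat (simpleRoot i))⁻¹ +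
    SkewMonoidAlgebra.single 1 (1 - expRat (-simpleRoot i))⁻¹

/-- `T_w = T_{s_{i₁}} ⋯ T_{s_{iₙ}}` for a word `w = s_{i₁} ⋯ s_{iₙ}`. -/
def nilTWord (l : List (Fin 2)) : NilHecke := (l.map nilT).prod

/-- The coefficient `b_{w, v}` of `δ_v` in `T_w`. -/
def b (l : List (Fin 2)) (v : Weyl) : RatFun := (nilTWord l).coeff v

/-- The reduced word of the `n`-th minimal coset representative: `w₀ = e`, `w₁ = s₀`,
`w₂ = s₁ s₀`, `w₃ = s₀ s₁ s₀`, …. -/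
def word : ℕ → List (Fin 2)
  | 0 => []
  | n + 1 => (if Even n then 0 else 1) :: word n

/-- The Weyl group element `wₙ`. -/
def w (n : ℕ) : Weyl := weylOfWord (word n)

/-- The rational function `R_m(X_n) = ∑_{v ∈ w_m W} \overline{b_{w_n, v}}` attached to the fixed
point `w_m W` in the localization formula of the Schubert variety `X_n = X_{w_n}`. -/
def schubertR (m n : ℕ) : RatFun :=
  ∑ᶠ (v : Weyl) (_ : (v : Weyl ⧸ finiteWeyl) = (w m : Weyl ⧸ finiteWeyl)), bar (b (word n) v)

/-- For a word `s_{i₁} ⋯ s_{iₙ}`, the weight `∑_j s_{i₁} ⋯ s_{i_{j-1}} α_{i_j}`. -/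
def f (l : List (Fin 2)) : CharLattice :=
  ∑ j : Fin l.length, (weylOfWord (l.take j)).1 (simpleRoot (l.get j))

/-! ### The formal completion -/

/-- The dominance order: `λ ≤ μ` if and only if `μ - λ ∈ ℕ α₀ + ℕ α₁`. -/
instance : PartialOrder CharLattice where
  le x y := ∃ p q : ℕ, y = x + p • simpleRoot 0 + q • simpleRoot 1
  le_refl x := ⟨0, 0, by simp⟩
  le_trans := by
    rintro x y z ⟨p, q, rfl⟩ ⟨p', q', rfl⟩
    exact ⟨p + p', q + q', by simp only [add_smul]; abel⟩
  le_antisymm := by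
    rintro x y ⟨p, q, rfl⟩ ⟨p', q', h⟩
    have h0 : (p + p') • simpleRoot 0 + (q + q') • simpleRoot 1 = 0 := by
      have h1 : x + ((p + p') • simpleRoot 0 + (q + q') • simpleRoot 1) = x + 0 := by
        rw [add_zero]
        nth_rw 2 [h]
        simp only [add_smul]
        abel
      exact add_left_cancel h1
    have h1 := congrArg (fun z : ℤ × ℤ => z.1) h0
    have h2 := congrArg (fun z : ℤ × ℤ => z.2) h0
    change (p + p') • (-2 : ℤ) + (q + q') • (2 : ℤ) = 0 at h1
    change (p + p') • (1 : ℤ) + (q + q') • (0 : ℤ) = 0 at h2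
    simp only [nsmul_eq_mul, Nat.cast_add] at h1 h2
    obtain rfl : p = 0 := by omega
    obtain rfl : q = 0 := by omega
    simp

instance : IsOrderedAddMonoid CharLattice where
  add_le_add_left := by
    rintro x y ⟨p, q, rfl⟩ z
    exact ⟨p, q, by abel⟩

/-- The completion of the group ring: formal sums `∑ n_λ e^λ` with integer coefficients whose
support is partially well-ordered, that is, contained in a finite union of cones
`λᵢ + ℕ α₀ + ℕ α₁`. -/
abbrev Completion : Type := HahnSeries CharLattice ℤ

/-- Coefficientwise convergence of formal sums, the coefficients being discrete. -/
instance : TopologicalSpace Completion :=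
  TopologicalSpace.induced HahnSeries.coeff (Pi.topologicalSpace (t₂ := fun _ => ⊥))

/-- The exponential `e^λ` as a formal sum. -/
def e (a : CharLattice) : Completion := HahnSeries.single a 1

/-- A finite sum of exponentials, seen as a formal sum. -/
def toCompletion : CharRing →+* Completion :=
  (AddMonoidAlgebra.lift ℤ Completion CharLattice
    { toFun := fun a => e a.toAdd
      map_one' := rfl
      map_mul' := fun x y => by simp [e, HahnSeries.single_mul_single] }).toRingHom

theorem toCompletion_single (a : CharLattice) :
    toCompletion (AddMonoidAlgebra.single a 1) = e a := by
  simp [toCompletion]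
  rfl

/-- `F` is the expansion of the rational function `r` as a formal sum: `r = p / q` with `p, q` in
the group ring, `q` invertible in the completion, and `F = p q⁻¹` in the completion. -/
def IsExpansion (r : RatFun) (F : Completion) : Prop :=
  ∃ p q : CharRing, IsUnit (toCompletion q) ∧
    r * algebraMap CharRing RatFun q = algebraMap CharRing RatFun p ∧
    F * toCompletion q = toCompletion p

theorem IsExpansion.unique {r : RatFun} {F G : Completion} (hF : IsExpansion r F)
    (hG : IsExpansion r G) : F = G := by
  obtain ⟨p, q, hq, h1, h2⟩ := hF
  obtain ⟨p', q', hq', h1', h2'⟩ := hG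
  have h : p * q' = p' * q := by
    apply IsFractionRing.injective CharRing RatFun
    rw [map_mul, map_mul, ← h1, ← h1']
    ring
  have h3 := congrArg toCompletion h
  rw [map_mul, map_mul, ← h2, ← h2'] at h3
  apply (hq.mul hq').mul_right_cancel
  linear_combination h3

instance : T2Space Completion := by
  let : TopologicalSpace ℤ := ⊥
  have : DiscreteTopology ℤ := ⟨rfl⟩
  exact T2Space.of_injective_continuous (f := (HahnSeries.coeff : Completion → CharLattice → ℤ))
    HahnSeries.coeff_injective continuous_induced_dom

/-- `R` is the function attached to the fixed point `w_m` in the localization formula of `ΩSU(2)`: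
the limit as `n → ∞` of the rational functions `R_m(X_n)` of the Schubert varieties. -/
def IsLocalizationFunction (m : ℕ) (R : Completion) : Prop :=
  ∃ E : ℕ → Completion, (∀ n, IsExpansion (schubertR m n) (E n)) ∧ Tendsto E atTop (𝓝 R)

theorem IsLocalizationFunction.unique {m : ℕ} {R S : Completion}
    (hR : IsLocalizationFunction m R) (hS : IsLocalizationFunction m S) : R = S := by
  obtain ⟨E, hE, hER⟩ := hR
  obtain ⟨E', hE', hES⟩ := hS
  obtain rfl : E = E' := funext fun n => (hE n).unique (hE' n)
  exact tendsto_nhds_unique hER hES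

/-- The positive real roots `α₁` and `± α₁ + n δ`, `n ≥ 1`. -/
def posRealRoots : Set CharLattice :=
  {simpleRoot 1} ∪ {a | ∃ n : ℕ, 1 ≤ n ∧
    (a = simpleRoot 1 + n • delta ∨ a = -simpleRoot 1 + n • delta)}

/-- The number of partitions of `n`. -/
def numPartitions (n : ℕ) : ℕ := Fintype.card (Nat.Partition n)

end

end AffineSL2

/-! Write `q = e^δ` and `[k]! = ∏_{i=1}^k (1 - q^i)`. Cosets of the finite Weyl group are indexed by
integers `j` (translations by `jδ`), and `s₁`, `s₀` act by `j ↦ -j` and `j ↦ -1 - j`. The fixed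
points of `X_n` form the interval `[low n, high n]`, which has `n + 1` elements. The crux is a
closed form (`schubertRat_eq`): the function at `j` is the Gaussian binomial `[n]! / ([j - low n]!
[high n - j]!)` divided by the product over the other fixed points `j'` of `1 - e^β`, with `β = ±
(α₁ + (j + j')δ)`. It follows by induction on `n` from left multiplication by `T_{sᵢ}`; once common
factors are removed, the induction step is the identity `quantum_pascal`.

Next, every `β` is made positive. Exactly `m` of them are negative at `w_m`; they are the negatives
of the roots summed in `f(w_m)`, and flipping them yields `(-1)^m e^{f(w_m)}`. The absent index `j'
= j` would contribute the root `w_m α₁`, which explains the numerator `1 - e^{w_m α₁}` once the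
product is completed (`schubertR_of_le`).

As `n → ∞`, the Gaussian binomial tends to `1 / ∏ (1 - q^i) = ∑ P(n) q^n`, and the intervals of
roots exhaust the positive real roots. These limits are taken among power series in `e^{α₀},
e^{α₁}`, where multiplication is continuous, then carried to the completion by the continuous
homomorphism `rootSeriesHom`. -/

namespace AffineSL2

noncomputable section

/-! ### Coordinates on the character lattice -/

/-- The character `a ω + d δ`. -/
def lat (a d : ℤ) : CharLattice := ((a, d) : ℤ × ℤ)

theorem exists_eq_lat (x : CharLattice) : ∃ a d, x = lat a d := ⟨x.1, x.2, rfl⟩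

theorem lat_inj {a d a' d' : ℤ} : lat a d = lat a' d' ↔ a = a' ∧ d = d' := Prod.mk_inj

theorem lat_add (a d a' d' : ℤ) : lat a d + lat a' d' = lat (a + a') (d + d') := rfl

theorem neg_lat (a d : ℤ) : -lat a d = lat (-a) (-d) := rfl

theorem zero_eq_lat : (0 : CharLattice) = lat 0 0 := rfl

theorem delta_eq_lat : delta = lat 0 1 := rfl

theorem zsmul_lat (n a d : ℤ) : n • lat a d = lat (n * a) (n * d) := rfl

theorem nsmul_lat (n : ℕ) (a d : ℤ) : n • lat a d = lat (n * a) (n * d) := by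
  rw [← zsmul_lat, natCast_zsmul]

/-- The multiple of `δ` in the affine hyperplane of the reflection `sᵢ`. -/
def wallShift (i : Fin 2) : ℤ := if i = 0 then 1 else 0

theorem simpleRoot_eq_lat (i : Fin 2) :
    simpleRoot i = lat (2 - 4 * wallShift i) (wallShift i) := by
  fin_cases i <;> rfl

theorem reflection_lat (i : Fin 2) (a d : ℤ) :
    reflection i (lat a d) = lat (-a) (d + wallShift i * a) := by
  have h : reflection i (lat a d) = lat a d - simpleCoroot i (lat a d) • simpleRoot i :=
    Module.reflection_apply _ _
  have h' : simpleCoroot i (lat a d) = (1 - 2 * wallShift i) * a := by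
    fin_cases i
    · exact (by ring : -a = (1 - 2 * 1) * a)
    · exact (by ring : a = (1 - 2 * 0) * a)
  rw [h, h', simpleRoot_eq_lat, zsmul_lat, sub_eq_add_neg, neg_lat, lat_add, lat_inj]
  fin_cases i <;> constructor <;> simp [wallShift] <;> ring

/-! ### Cosets of the finite Weyl group -/

/-- Maps of this shape are closed under composition and inversion and include both reflections: `ε`
is the sign on `ω` modulo `δ`, and `j` is the translation part. -/
theorem exists_weyl_apply (v : Weyl) :
    ∃ ε j : ℤ, (ε = 1 ∨ ε = -1) ∧ ∀ a d, v.1 (lat a d) = lat (ε * a) (d + ε * j * a) := by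
  obtain ⟨g, hg⟩ := v
  induction hg using Subgroup.closure_induction with
  | mem x hx =>
    obtain ⟨i, rfl⟩ := hx
    refine ⟨-1, -wallShift i, Or.inr rfl, fun a d => ?_⟩
    rw [reflection_lat, lat_inj]
    constructor <;> ring
  | one => exact ⟨1, 0, Or.inl rfl, fun a d => by simp⟩
  | mul x y hx hy ihx ihy =>
    obtain ⟨ε, j, hε, h⟩ := ihx
    obtain ⟨ε', j', hε', h'⟩ := ihy
    dsimp only at h h' ⊢
    refine ⟨ε * ε', ε * j' + j, ?_, fun a d => ?_⟩
    · rcases hε with rfl | rfl <;> rcases hε' with rfl | rfl <;> simp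
    · rw [LinearEquiv.mul_apply, h', h, lat_inj]
      rcases hε with rfl | rfl <;> constructor <;> ring
  | inv x hx ih =>
    obtain ⟨ε, j, hε, h⟩ := ih
    dsimp only at h ⊢
    refine ⟨ε, -(ε * j), hε, fun a d => ?_⟩
    change x.symm (lat a d) = _
    rw [LinearEquiv.symm_apply_eq, h, lat_inj]
    rcases hε with rfl | rfl <;> constructor <;> ring

/-- The integer `j` with `v W = t_j W`, where `t_j` is the translation `ω ↦ ω + j δ`. -/
def cosetIndex (v : Weyl) : ℤ := (v.1 (lat 1 0) : CharLattice).1 * (v.1 (lat 1 0) : CharLattice).2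

theorem cosetIndex_eq {v : Weyl} {ε j : ℤ} (hε : ε = 1 ∨ ε = -1)
    (h : ∀ a d, v.1 (lat a d) = lat (ε * a) (d + ε * j * a)) : cosetIndex v = j := by
  rw [cosetIndex, h]
  change ε * 1 * (0 + ε * j * 1) = j
  rcases hε with rfl | rfl <;> ring

theorem exists_weyl_apply_cosetIndex (v : Weyl) : ∃ ε : ℤ, (ε = 1 ∨ ε = -1) ∧
    ∀ a d, v.1 (lat a d) = lat (ε * a) (d + ε * cosetIndex v * a) := by
  obtain ⟨ε, j, hε, h⟩ := exists_weyl_apply v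
  exact ⟨ε, hε, by rwa [cosetIndex_eq hε h]⟩

theorem s_apply (i : Fin 2) (a d : ℤ) : (s i).1 (lat a d) = lat (-a) (d + wallShift i * a) :=
  reflection_lat i a d

/-- The action of `sᵢ` on cosets of the finite Weyl group. -/
def flip (i : Fin 2) (j : ℤ) : ℤ := -wallShift i - j

theorem flip_flip (i : Fin 2) (j : ℤ) : flip i (flip i j) = j := by simp [flip]

theorem cosetIndex_one : cosetIndex 1 = 0 := by
  refine cosetIndex_eq (Or.inl rfl) fun a d => ?_
  simp

/-- On indices the simple reflections are the reflections of the line about `0` and `-1/2`. -/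
theorem cosetIndex_s_mul (i : Fin 2) (v : Weyl) : cosetIndex (s i * v) = flip i (cosetIndex v) := by
  obtain ⟨ε, hε, h⟩ := exists_weyl_apply_cosetIndex v
  refine cosetIndex_eq (ε := -ε) (by omega) fun a d => ?_
  rw [Subgroup.coe_mul, LinearEquiv.mul_apply, h, s_apply, lat_inj, flip]
  constructor <;> ring

theorem weyl_ext {v v' : Weyl} (h : ∀ a d, v.1 (lat a d) = v'.1 (lat a d)) : v = v' := by
  refine Subtype.ext (LinearEquiv.ext fun x => ?_)
  obtain ⟨a, d, rfl⟩ := exists_eq_lat x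
  exact h a d

/-- Right multiplication by `s₁` changes only the sign `ε`, so the translation part is a complete
invariant of the coset. -/
theorem coset_eq_iff (v v' : Weyl) :
    (v : Weyl ⧸ finiteWeyl) = (v' : Weyl ⧸ finiteWeyl) ↔ cosetIndex v = cosetIndex v' := by
  rw [QuotientGroup.eq]
  constructor
  · intro h
    obtain ⟨g, rfl⟩ : ∃ g, v' = v * g := ⟨v⁻¹ * v', by group⟩
    rw [inv_mul_cancel_left] at h
    obtain ⟨ε, hε, hv⟩ := exists_weyl_apply_cosetIndex v
    obtain ⟨η, hη, hg⟩ : ∃ η : ℤ, (η = 1 ∨ η = -1) ∧ ∀ a d, g.1 (lat a d) = lat (η * a) d := by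
      induction h using Subgroup.closure_induction with
      | mem x hx =>
        obtain rfl := Set.mem_singleton_iff.1 hx
        exact ⟨-1, Or.inr rfl, fun a d => by rw [s_apply]; simp [wallShift]⟩
      | one => exact ⟨1, Or.inl rfl, fun a d => by simp⟩
      | mul x y hx hy ihx ihy =>
        obtain ⟨η, hη, h⟩ := ihx
        obtain ⟨η', hη', h'⟩ := ihy
        refine ⟨η * η', by rcases hη with rfl | rfl <;> rcases hη' with rfl | rfl <;> simp,
          fun a d => ?_⟩
        rw [Subgroup.coe_mul, LinearEquiv.mul_apply, h', h, mul_assoc]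
      | inv x hx ih =>
        obtain ⟨η, hη, h⟩ := ih
        refine ⟨η, hη, fun a d => ?_⟩
        change x.1.symm (lat a d) = _
        rw [LinearEquiv.symm_apply_eq, h]
        rcases hη with rfl | rfl <;> simp
    symm
    refine cosetIndex_eq (ε := ε * η)
      (by rcases hη with rfl | rfl <;> rcases hε with rfl | rfl <;> simp) fun a d => ?_
    rw [Subgroup.coe_mul, LinearEquiv.mul_apply, hg, hv, lat_inj]
    constructor <;> ring
  · intro h
    obtain ⟨ε, hε, hv⟩ := exists_weyl_apply_cosetIndex v
    obtain ⟨ε', hε', hv'⟩ := exists_weyl_apply_cosetIndex v'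
    rw [← h] at hv'
    by_cases hs : ε = ε'
    · obtain rfl : v = v' := weyl_ext fun a d => by rw [hv, hv', hs]
      simp [finiteWeyl.one_mem]
    -- Same translation part and opposite signs: the two elements differ by `s₁` on the right.
    · obtain rfl : v' = v * s 1 := by
        refine weyl_ext fun a d => ?_
        rw [Subgroup.coe_mul, LinearEquiv.mul_apply, s_apply, hv, hv', lat_inj,
          show ε' = -ε by omega]
        simp [wallShift]
      rw [inv_mul_cancel_left]
      exact Subgroup.subset_closure rfl

/-! ### Exponentials in the field of rational functions -/

theorem expRat_add (a b : CharLattice) : expRat (a + b) = expRat a * expRat b := by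
  rw [expRat, expRat, expRat, ← map_mul, AddMonoidAlgebra.single_mul_single, one_mul]

theorem expRat_zero : expRat 0 = 1 := map_one _

theorem expRat_injective : Function.Injective expRat := fun a b h => by
  have h1 := IsFractionRing.injective CharRing RatFun h
  rcases AddMonoidAlgebra.single_inj.1 h1 with h2 | h2
  · exact h2.1
  · exact absurd h2.1 one_ne_zero

theorem expRat_ne_zero (a : CharLattice) : expRat a ≠ 0 := fun h => by
  have h1 := expRat_add a (-a)
  rw [h, zero_mul, add_neg_cancel, expRat_zero] at h1
  exact one_ne_zero h1

theorem expRat_neg (a : CharLattice) : expRat (-a) = (expRat a)⁻¹ := by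
  refine eq_inv_of_mul_eq_one_left ?_
  rw [← expRat_add, neg_add_cancel, expRat_zero]

theorem one_sub_expRat_ne_zero {a : CharLattice} (ha : a ≠ 0) : 1 - expRat a ≠ 0 := fun h => by
  rw [sub_eq_zero, ← expRat_zero] at h
  exact ha (expRat_injective h).symm

theorem one_sub_expRat_lat_ne_zero {a d : ℤ} (h : a ≠ 0 ∨ d ≠ 0) : 1 - expRat (lat a d) ≠ 0 :=
  one_sub_expRat_ne_zero fun h' => by
    rw [zero_eq_lat, lat_inj] at h'
    omega

theorem bar_expRat (a : CharLattice) : bar (expRat a) = expRat (-a) := by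
  change IsFractionRing.ringEquivOfRingEquiv _ (algebraMap CharRing RatFun _) = _
  rw [IsFractionRing.ringEquivOfRingEquiv_algebraMap]
  simp [expRat]

theorem bar_smul (v : Weyl) (x : RatFun) : bar (v • x) = v • bar x := by
  change (ratFunAut (LinearEquiv.neg ℤ) * ratFunAut v.1) x =
    (ratFunAut v.1 * ratFunAut (LinearEquiv.neg ℤ)) x
  rw [← map_mul, ← map_mul]
  congr 2
  ext y
  simp [LinearEquiv.mul_apply]

theorem smul_inv_ratFun (v : Weyl) (x : RatFun) : v • x⁻¹ = (v • x)⁻¹ :=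
  map_inv₀ (ratFunAut v.1) x

/-! ### The recursion for the rational functions of Schubert varieties -/

/-- The sum of the coefficients of an element of the nil-Hecke ring over a coset. -/
def cosetSum (j : ℤ) : NilHecke →+ RatFun :=
  (Finsupp.liftAddHom fun v : Weyl => if cosetIndex v = j then AddMonoidHom.id RatFun else 0).comp
    SkewMonoidAlgebra.coeffAddEquiv.toAddMonoidHom

theorem cosetSum_single (j : ℤ) (v : Weyl) (x : RatFun) :
    cosetSum j (SkewMonoidAlgebra.single v x) = if cosetIndex v = j then x else 0 := by
  change Finsupp.sum (Finsupp.single v x) _ = _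
  dsimp only
  rw [Finsupp.sum_single_index (by split_ifs <;> rfl)]
  split_ifs <;> rfl

/-- Left multiplication by `δ_{sᵢ}` permutes left cosets, so the sums over cosets satisfy a closed
recursion; individual coefficients are not needed. -/
theorem cosetSum_nilT_mul (j : ℤ) (i : Fin 2) (F : NilHecke) :
    cosetSum j (nilT i * F) = (1 - expRat (simpleRoot i))⁻¹ * (s i • cosetSum (flip i j) F) +
      (1 - expRat (-simpleRoot i))⁻¹ * cosetSum j F := by
  induction F using SkewMonoidAlgebra.induction_on with
  | zero => simp
  | add F G hF hG => rw [mul_add, map_add, hF, hG, map_add, map_add, smul_add]; ring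
  | single v x =>
    rw [nilT, add_mul, SkewMonoidAlgebra.single_mul_single, SkewMonoidAlgebra.single_mul_single,
      map_add, cosetSum_single, cosetSum_single, cosetSum_single, cosetSum_single,
      cosetIndex_s_mul, one_mul, one_smul]
    have h : flip i (cosetIndex v) = j ↔ cosetIndex v = flip i j :=
      ⟨fun h => by rw [← h, flip_flip], fun h => by rw [h, flip_flip]⟩
    simp only [h]
    split_ifs <;> simp

theorem schubertR_eq (m n : ℕ) :
    schubertR m n = bar (cosetSum (cosetIndex (w m)) (nilTWord (word n))) := by
  have h1 : ∀ v : Weyl, (∑ᶠ (_ : (v : Weyl ⧸ finiteWeyl) = (w m : Weyl ⧸ finiteWeyl)),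
      bar (b (word n) v)) = if cosetIndex v = cosetIndex (w m) then bar (b (word n) v) else 0 :=
    fun v => by simp only [coset_eq_iff, finsum_eq_if]
  rw [schubertR, finsum_congr h1, finsum_eq_sum_of_support_subset (s := (nilTWord (word n)).support)]
  · change _ = bar (Finsupp.sum (nilTWord (word n)).coeff _)
    rw [Finsupp.sum, map_sum]
    refine Finset.sum_congr rfl fun v _ => ?_
    dsimp only
    split_ifs <;> simp [b]
  · intro v hv
    rw [Finset.mem_coe, SkewMonoidAlgebra.mem_support_iff]
    intro h
    simp [b, h] at hv

/-- The first letter of the word of length `n + 1`. -/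
def letter (n : ℕ) : Fin 2 := if Even n then 0 else 1

theorem wallShift_letter (n : ℕ) : wallShift (letter n) = 1 - (n : ℤ) % 2 := by
  rcases Nat.even_or_odd' n with ⟨k, rfl | rfl⟩
  · rw [letter, if_pos (by simp)]; simp [wallShift]
  · rw [letter, if_neg (by simp)]; simp [wallShift]

theorem w_succ (n : ℕ) : w (n + 1) = s (letter n) * w n := by
  rw [w, word, weylOfWord, List.map_cons, List.prod_cons]; rfl

/-- The sum of the coefficients of `T_{w_n}`, conjugated, over the coset of index `j`. -/
def schubertRat (n : ℕ) (j : ℤ) : RatFun := bar (cosetSum j (nilTWord (word n)))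

theorem schubertRat_zero (j : ℤ) : schubertRat 0 j = if j = 0 then 1 else 0 := by
  rw [schubertRat, word, nilTWord, List.map_nil, List.prod_nil, SkewMonoidAlgebra.one_def,
    cosetSum_single, cosetIndex_one]
  simp only [eq_comm (a := (0 : ℤ))]
  split_ifs <;> simp

theorem schubertRat_succ (n : ℕ) (j : ℤ) :
    schubertRat (n + 1) j =
      (1 - expRat (-simpleRoot (letter n)))⁻¹ *
        (s (letter n) • schubertRat n (flip (letter n) j)) +
      (1 - expRat (simpleRoot (letter n)))⁻¹ * schubertRat n j := by
  rw [schubertRat, word, nilTWord, List.map_cons, List.prod_cons]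
  change bar (cosetSum j (nilT (letter n) * nilTWord (word n))) = _
  rw [cosetSum_nilT_mul, map_add, map_mul, map_mul, map_inv₀, map_inv₀, map_sub, map_sub,
    map_one, bar_expRat, bar_expRat, neg_neg, bar_smul]
  rfl

/-! ### Quantum factorials -/

/-- The finite product `∏_{i=1}^n (1 - e^{iδ})`. -/
def qFactorial (n : ℕ) : RatFun := ∏ i ∈ Finset.range n, (1 - expRat (lat 0 (i + 1)))

theorem qFactorial_succ (n : ℕ) :
    qFactorial (n + 1) = qFactorial n * (1 - expRat (lat 0 (n + 1))) :=
  Finset.prod_range_succ _ _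

/-- The inverse of the quantum factorial, extended by `0` to the negative integers. -/
def qFactorialInv (k : ℤ) : RatFun := if k < 0 then 0 else (qFactorial k.toNat)⁻¹

theorem qFactorialInv_natCast (k : ℕ) : qFactorialInv k = (qFactorial k)⁻¹ := by
  simp [qFactorialInv]

theorem qFactorialInv_of_neg {k : ℤ} (hk : k < 0) : qFactorialInv k = 0 := if_pos hk

/-- The extension by zero makes this valid for all integers: at `k = 0` it reads `0 = (1 - q^0) ·
1`. The recursion thereby covers the endpoints of the interval without separate cases. -/
theorem qFactorialInv_sub_one (k : ℤ) :
    qFactorialInv (k - 1) = (1 - expRat (lat 0 k)) * qFactorialInv k := by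
  rcases lt_trichotomy k 0 with hk | rfl | hk
  · rw [qFactorialInv_of_neg hk, qFactorialInv_of_neg (by omega), mul_zero]
  · rw [qFactorialInv_of_neg (by omega), ← zero_eq_lat, expRat_zero, sub_self, zero_mul]
  · obtain ⟨n, rfl⟩ : ∃ n : ℕ, k = n + 1 := ⟨(k - 1).toNat, by omega⟩
    rw [add_sub_cancel_right, qFactorialInv_natCast, ← Nat.cast_succ, qFactorialInv_natCast,
      Nat.succ_eq_add_one, qFactorial_succ, mul_inv, Nat.cast_succ, mul_left_comm, mul_inv_cancel₀,
      mul_one]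
    exact one_sub_expRat_lat_ne_zero (Or.inr (by omega))

theorem smul_expRat_imaginary (v : Weyl) (k : ℤ) : v • expRat (lat 0 k) = expRat (lat 0 k) := by
  obtain ⟨ε, -, h⟩ := exists_weyl_apply_cosetIndex v
  rw [smul_expRat, h]
  simp

theorem smul_qFactorial (v : Weyl) (n : ℕ) : v • qFactorial n = qFactorial n := by
  rw [qFactorial, Finset.smul_prod']
  exact Finset.prod_congr rfl fun i _ => by rw [smul_sub, smul_one, smul_expRat_imaginary]

theorem smul_qFactorialInv (v : Weyl) (k : ℤ) : v • qFactorialInv k = qFactorialInv k := by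
  rw [qFactorialInv]
  split_ifs
  · exact smul_zero _
  · rw [smul_inv_ratFun, smul_qFactorial]

/-! ### Tangent weights at the fixed points -/

/-- The factor `1 - e^β`, where `β` is up to sign the tangent weight at the fixed point `j` of the
invariant curve joining the fixed points `j` and `j'`. -/
def curveFactor (j j' : ℤ) : RatFun :=
  1 - expRat (lat (2 * (j' - j).sign) ((j' - j).sign * (j + j')))

theorem curveFactor_ne_zero {j j' : ℤ} (h : j' ≠ j) : curveFactor j j' ≠ 0 :=
  one_sub_expRat_lat_ne_zero (Or.inl (by simp [sub_eq_zero, h]))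

/-- The reflection reverses the order of the indices, and this sign cancels the sign of `sᵢ` on the
`ω`-component. -/
theorem smul_curveFactor (i : Fin 2) (j j' : ℤ) :
    s i • curveFactor (flip i j) (flip i j') = curveFactor j j' := by
  have h : flip i j' - flip i j = -(j' - j) := by simp [flip]
  rw [curveFactor, curveFactor, smul_sub, smul_one, smul_expRat, s_apply, h, Int.sign_neg]
  congr 3
  · ring
  · simp only [flip]; ring

/-- The product of the factors of all curves joining `j` to fixed points in `S`. -/
def curveProd (S : Finset ℤ) (j : ℤ) : RatFun := ∏ j' ∈ S.erase j, curveFactor j j'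

theorem curveProd_insert {S : Finset ℤ} {j a : ℤ} (ha : a ∉ S) (hj : j ≠ a) :
    curveProd (insert a S) j = curveFactor j a * curveProd S j := by
  rw [curveProd, Finset.erase_insert_of_ne hj.symm,
    Finset.prod_insert fun h => ha (Finset.mem_of_mem_erase h), curveProd]

theorem smul_curveProd (i : Fin 2) (S T : Finset ℤ) (j : ℤ) (h : ∀ x, x ∈ T ↔ flip i x ∈ S) :
    s i • curveProd S (flip i j) = curveProd T j := by
  rw [curveProd, Finset.smul_prod', curveProd]
  refine Finset.prod_nbij' (flip i) (flip i) ?_ ?_ (fun x _ => flip_flip i x)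
    (fun x _ => flip_flip i x) ?_
  · intro x hx
    rw [Finset.mem_erase] at hx ⊢
    refine ⟨fun h' => hx.1 (by rw [← h', flip_flip]), ?_⟩
    rw [h, flip_flip]; exact hx.2
  · intro x hx
    rw [Finset.mem_erase] at hx ⊢
    refine ⟨fun h' => hx.1 (by rw [← flip_flip i x, h', flip_flip]), (h x).1 hx.2⟩
  · intro x _
    rw [← smul_curveFactor i j, flip_flip]

/-- The lowest index of a fixed point of the Schubert variety of dimension `n`. -/
def low (n : ℕ) : ℤ := -((n + 1) / 2)

/-- The highest index of a fixed point of the Schubert variety of dimension `n`. -/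
def high (n : ℕ) : ℤ := n / 2

/-- The one-step identity between the rational functions with the roots of a rank-one
subsystem, divided by the common factors. -/
theorem quantum_pascal {K : Type*} [Field K] {x U V : K} (hx : x ≠ 0) (hx1 : 1 - x ≠ 0) :
    (1 - x⁻¹)⁻¹ * ((1 - V) * (1 - x⁻¹ * U)) + (1 - x)⁻¹ * ((1 - U) * (1 - x * V)) =
      1 - U * V := by
  have h : (1 - x⁻¹)⁻¹ = -x * (1 - x)⁻¹ := by
    have : 1 - x⁻¹ = -(1 - x) * x⁻¹ := by field_simp; ring
    rw [this, mul_inv, inv_inv, inv_neg]; ring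
  rw [h]
  field_simp
  ring

/-- The rational functions of the Schubert variety with fixed points `S`, if those with fixed points
`S₀` and its reflection `S₁` are known. -/
theorem schubert_step {n : ℕ} {i : Fin 2} {S₀ S₁ S : Finset ℤ} {a c : ℤ} {j u v : ℤ}
    (ha : a ∉ S₀) (hS : S = insert a S₀) (hc : c ∉ S₁) (hS' : S = insert c S₁)
    (hflip : ∀ x, x ∈ S₁ ↔ flip i x ∈ S₀) (huv : u + v = n + 1)
    (hu : j = a ↔ u = 0) (hv : j = c ↔ v = 0)
    (hau : 0 < u → 0 ≤ v → curveFactor j a = 1 - expRat (simpleRoot i) * expRat (lat 0 v))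
    (hcv : 0 < v → 0 ≤ u → curveFactor j c = 1 - expRat (-simpleRoot i) * expRat (lat 0 u)) :
    (1 - expRat (-simpleRoot i))⁻¹ * (s i • (qFactorial n * qFactorialInv (v - 1) *
        qFactorialInv u * (curveProd S₀ (flip i j))⁻¹)) +
      (1 - expRat (simpleRoot i))⁻¹ * (qFactorial n * qFactorialInv (u - 1) * qFactorialInv v *
        (curveProd S₀ j)⁻¹) =
    qFactorial (n + 1) * qFactorialInv u * qFactorialInv v * (curveProd S j)⁻¹ := by
  rw [smul_mul', smul_mul', smul_mul', smul_qFactorial, smul_qFactorialInv, smul_qFactorialInv,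
    smul_inv_ratFun, smul_curveProd i S₀ S₁ j hflip, qFactorialInv_sub_one, qFactorialInv_sub_one,
    qFactorial_succ]
  -- All terms now contain `1/[u]!` and `1/[v]!`, so both sides vanish if `j` lies outside `S`.
  rcases lt_or_ge u 0 with hu0 | hu0
  · simp [qFactorialInv_of_neg hu0]
  rcases lt_or_ge v 0 with hv0 | hv0
  · simp [qFactorialInv_of_neg hv0]
  -- Passing from `S₀` to `S` adds the curve to `a`. If `j = a` there is no such curve, but then `u
  -- = 0` and `1 - q^u` kills both sides.
  have h1 : (1 - expRat (lat 0 u)) * (curveProd S₀ j)⁻¹ = (1 - expRat (lat 0 u)) *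
      (1 - expRat (simpleRoot i) * expRat (lat 0 v)) * (curveProd S j)⁻¹ := by
    rcases eq_or_ne j a with h | h
    · rw [hu.1 h, ← zero_eq_lat, expRat_zero]; simp
    · rw [hS, curveProd_insert ha h, ← hau (by have := mt hu.2 h; omega) hv0, mul_inv, mul_assoc,
        mul_inv_cancel_left₀ (curveFactor_ne_zero h.symm)]
  have h2 : (1 - expRat (lat 0 v)) * (curveProd S₁ j)⁻¹ = (1 - expRat (lat 0 v)) *
      (1 - expRat (-simpleRoot i) * expRat (lat 0 u)) * (curveProd S j)⁻¹ := by
    rcases eq_or_ne j c with h | h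
    · rw [hv.1 h, ← zero_eq_lat, expRat_zero]; simp
    · rw [hS', curveProd_insert hc h, ← hcv (by have := mt hv.2 h; omega) hu0, mul_inv, mul_assoc,
        mul_inv_cancel_left₀ (curveFactor_ne_zero h.symm)]
  have h3 : expRat (lat 0 (n + 1)) = expRat (lat 0 u) * expRat (lat 0 v) := by
    rw [← expRat_add, lat_add, huv, add_zero]
  have h4 := quantum_pascal (U := expRat (lat 0 u)) (V := expRat (lat 0 v))
    (expRat_ne_zero (simpleRoot i)) (one_sub_expRat_ne_zero (a := simpleRoot i) (by
      rw [simpleRoot_eq_lat, zero_eq_lat, Ne, lat_inj]; omega))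
  rw [← expRat_neg] at h4
  rw [h3, ← h4]
  linear_combination
    (1 - expRat (-simpleRoot i))⁻¹ * qFactorial n * qFactorialInv v * qFactorialInv u * h2 +
    (1 - expRat (simpleRoot i))⁻¹ * qFactorial n * qFactorialInv v * qFactorialInv u * h1

/-- The closed form of the rational functions of the Schubert varieties. -/
theorem schubertRat_eq (n : ℕ) (j : ℤ) :
    schubertRat n j = qFactorial n * qFactorialInv (j - low n) * qFactorialInv (high n - j) *
      (curveProd (Finset.Icc (low n) (high n)) j)⁻¹ := by
  induction n generalizing j with
  | zero =>
    rw [schubertRat_zero]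
    simp only [low, high, Nat.cast_zero, zero_add]
    norm_num
    rcases lt_trichotomy j 0 with hj | rfl | hj
    · rw [if_neg hj.ne, qFactorialInv_of_neg hj]; simp
    · simp [qFactorial, qFactorialInv, curveProd]
    · rw [if_neg hj.ne', qFactorialInv_of_neg (neg_lt_zero.2 hj)]; simp
  | succ n ih =>
    rw [schubertRat_succ, ih, ih]
    have hw := wallShift_letter n
    rcases Nat.even_or_odd' n with ⟨k, rfl | rfl⟩
    -- Here `s₀` sends `[-k, k]` to `[-k-1, k-1]`: the new fixed point is `-k-1`, and `k` is the one
    -- missed by the reflected interval.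
    · have hw : wallShift (letter (2 * k)) = 1 := by rw [hw]; simp
      have e1 : low (2 * k) = -k := by simp only [low]; omega
      have e2 : high (2 * k) = k := by simp only [high]; omega
      have e3 : low (2 * k + 1) = -k - 1 := by simp only [low]; omega
      have e4 : high (2 * k + 1) = k := by simp only [high]; omega
      rw [e1, e2, e3, e4]
      have := schubert_step (n := 2 * k) (i := letter (2 * k)) (S₀ := Finset.Icc (-k) k)
        (S₁ := Finset.Icc (-k - 1) (k - 1)) (S := Finset.Icc (-k - 1) k) (a := -k - 1) (c := k)
        (j := j) (u := j - (-k - 1)) (v := k - j) (by simp)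
        (by ext; simp only [Finset.mem_Icc, Finset.mem_insert]; omega) (by simp)
        (by ext; simp only [Finset.mem_Icc, Finset.mem_insert]; omega)
        (by intro x; simp only [Finset.mem_Icc, flip, hw]; omega) (by push_cast; ring) (by omega)
        (by omega)
        (by
          intro h _
          rw [curveFactor, Int.sign_eq_neg_one_of_neg (by omega), ← expRat_add, simpleRoot_eq_lat,
            lat_add, hw]
          congr 3; ring)
        (by
          intro h _
          rw [curveFactor, Int.sign_eq_one_of_pos (by omega), ← expRat_add, simpleRoot_eq_lat,
            neg_lat, lat_add, hw]
          congr 3; ring)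
      rw [← this, show flip (letter (2 * k)) j - -k = k - j - 1 by simp only [flip, hw]; ring,
        show k - flip (letter (2 * k)) j = j - (-k - 1) by simp only [flip, hw]; ring,
        show j - -k = j - (-k - 1) - 1 by ring]
    -- Here `s₁` sends `[-k-1, k]` to `[-k, k+1]`: the new fixed point is `k+1`, and `-k-1` is the
    -- one missed.
    · have hw : wallShift (letter (2 * k + 1)) = 0 := by rw [hw]; omega
      have e1 : low (2 * k + 1) = -k - 1 := by simp only [low]; omega
      have e2 : high (2 * k + 1) = k := by simp only [high]; omega
      have e3 : low (2 * k + 1 + 1) = -k - 1 := by simp only [low]; omega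
      have e4 : high (2 * k + 1 + 1) = k + 1 := by simp only [high]; omega
      rw [e1, e2, e3, e4]
      have := schubert_step (n := 2 * k + 1) (i := letter (2 * k + 1))
        (S₀ := Finset.Icc (-k - 1) k)
        (S₁ := Finset.Icc (-k) (k + 1)) (S := Finset.Icc (-k - 1) (k + 1)) (a := k + 1)
        (c := -k - 1)
        (j := j) (u := k + 1 - j) (v := j - (-k - 1)) (by simp)
        (by ext; simp only [Finset.mem_Icc, Finset.mem_insert]; omega) (by simp)
        (by ext; simp only [Finset.mem_Icc, Finset.mem_insert]; omega)
        (by intro x; simp only [Finset.mem_Icc, flip, hw]; omega) (by push_cast; ring) (by omega)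
        (by omega)
        (by
          intro h _
          rw [curveFactor, Int.sign_eq_one_of_pos (by omega), ← expRat_add, simpleRoot_eq_lat,
            lat_add, hw]
          congr 3; ring)
        (by
          intro h _
          rw [curveFactor, Int.sign_eq_neg_one_of_neg (by omega), ← expRat_add, simpleRoot_eq_lat,
            neg_lat, lat_add, hw]
          congr 3; ring)
      rw [mul_right_comm (qFactorial (2 * k + 1 + 1)), ← this,
        show flip (letter (2 * k + 1)) j - (-k - 1) = k + 1 - j by simp only [flip, hw]; ring,
        show k - flip (letter (2 * k + 1)) j = j - (-k - 1) - 1 by simp only [flip, hw]; ring,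
        show k - j = k + 1 - j - 1 by ring,
        mul_right_comm (qFactorial (2 * k + 1)) (qFactorialInv (k + 1 - j)),
        mul_right_comm (qFactorial (2 * k + 1)) (qFactorialInv (j - (-k - 1)))]

/-! ### Rewriting in terms of positive roots -/

/-- The positive real root among `± (α₁ + c δ)`. -/
def posRoot (c : ℤ) : CharLattice := if 0 ≤ c then lat 2 c else lat (-2) (-c)

theorem posRoot_ne_zero (c : ℤ) : posRoot c ≠ 0 := by
  rw [posRoot, zero_eq_lat]
  split_ifs <;> rw [Ne, lat_inj] <;> omega

theorem w_apply (n : ℕ) (a d : ℤ) :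
    (w n).1 (lat a d) = lat ((-1) ^ n * a) (d + ((n + 1) / 2 : ℤ) * a) := by
  induction n with
  | zero => simp [w, word, weylOfWord]
  | succ n ih =>
    rw [w_succ, Subgroup.coe_mul, LinearEquiv.mul_apply, ih, s_apply, wallShift_letter, lat_inj]
    refine ⟨by ring, ?_⟩
    rcases Nat.even_or_odd' n with ⟨k, rfl | rfl⟩
    · rw [show (((2 * k : ℕ) : ℤ) + 1) / 2 = k by omega,
        show (((2 * k + 1 : ℕ) : ℤ) + 1) / 2 = k + 1 by omega,
        show 1 - ((2 * k : ℕ) : ℤ) % 2 = 1 by omega, pow_mul]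
      ring
    · rw [show (((2 * k + 1 : ℕ) : ℤ) + 1) / 2 = k + 1 by omega,
        show (((2 * k + 1 + 1 : ℕ) : ℤ) + 1) / 2 = k + 1 by omega,
        show 1 - ((2 * k + 1 : ℕ) : ℤ) % 2 = 0 by omega]
      ring

theorem cosetIndex_w (n : ℕ) : cosetIndex (w n) = (-1) ^ n * ((n + 1) / 2 : ℤ) := by
  refine cosetIndex_eq (neg_one_pow_eq_or ℤ n) fun a d => ?_
  rw [w_apply, ← mul_assoc, ← mul_pow]
  simp

theorem cosetIndex_w_even (k : ℕ) : cosetIndex (w (2 * k)) = k := by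
  rw [cosetIndex_w, pow_mul]
  simp only [neg_one_sq, one_pow]
  omega

theorem cosetIndex_w_odd (k : ℕ) : cosetIndex (w (2 * k + 1)) = -k - 1 := by
  rw [cosetIndex_w, pow_succ, pow_mul]
  simp only [neg_one_sq, one_pow]
  omega

theorem w_apply_simpleRoot_one (m : ℕ) :
    (w m).1 (simpleRoot 1) = posRoot (2 * cosetIndex (w m)) := by
  rw [show simpleRoot 1 = lat 2 0 from rfl, w_apply, posRoot]
  rcases Nat.even_or_odd' m with ⟨k, rfl | rfl⟩
  · rw [cosetIndex_w_even, if_pos (by omega), lat_inj, pow_mul]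
    simp only [neg_one_sq, one_pow]
    omega
  · rw [cosetIndex_w_odd, if_neg (by omega), lat_inj, pow_succ, pow_mul]
    simp only [neg_one_sq, one_pow]
    omega

theorem f_cons (i : Fin 2) (l : List (Fin 2)) :
    f (i :: l) = simpleRoot i + reflection i (f l) := by
  have h : ∀ k, weylOfWord ((i :: l).take (k + 1)) = s i * weylOfWord (l.take k) := fun k => rfl
  rw [f, f, map_sum]
  refine (Fin.sum_univ_succ (n := l.length) _).trans ?_
  congr 1

/-- By the cocycle rule `f_cons`, a new letter reflects the earlier roots, moving each one place
along the chain, and puts its simple root at place `0`. -/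
theorem f_word (m : ℕ) :
    f (word m) = ∑ i ∈ Finset.range m, lat (2 * (-1) ^ m) (i + (m % 2 : ℤ)) := by
  induction m with
  | zero => exact Fin.sum_univ_zero _
  | succ n ih =>
    have h : f (word (n + 1)) = simpleRoot (letter n) + reflection (letter n) (f (word n)) :=
      f_cons _ _
    rw [h, ih, map_sum, Finset.sum_congr rfl fun i _ => reflection_lat _ _ _, simpleRoot_eq_lat]
    have hw := wallShift_letter n
    rcases Nat.even_or_odd' n with ⟨k, rfl | rfl⟩
    · rw [show wallShift (letter (2 * k)) = 1 by omega, add_comm]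
      conv_rhs => rw [Finset.sum_range_succ']
      congr 1
      · refine Finset.sum_congr rfl fun i _ => ?_
        rw [lat_inj, pow_succ, pow_mul]
        simp only [neg_one_sq, one_pow]
        omega
      · rw [lat_inj, pow_succ, pow_mul]
        simp only [neg_one_sq, one_pow]
        omega
    · rw [show wallShift (letter (2 * k + 1)) = 0 by omega, add_comm]
      conv_rhs => rw [Finset.sum_range_succ']
      congr 1
      · refine Finset.sum_congr rfl fun i _ => ?_
        rw [lat_inj]
        simp only [pow_succ _ (2 * k + 1), pow_succ _ (2 * k), pow_mul, neg_one_sq, one_pow]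
        omega
      · rw [lat_inj]
        simp only [pow_succ _ (2 * k + 1), pow_succ _ (2 * k), pow_mul, neg_one_sq, one_pow]
        omega

theorem expRat_sum {ι : Type*} (S : Finset ι) (g : ι → CharLattice) :
    expRat (∑ i ∈ S, g i) = ∏ i ∈ S, expRat (g i) := by
  classical
  induction S using Finset.induction_on with
  | empty => exact expRat_zero
  | insert a S ha ih => rw [Finset.sum_insert ha, Finset.prod_insert ha, expRat_add, ih]

/-- The condition says that the root in `curveFactor` is negative; then `1/(1 - e^{-β}) = -e^β/(1 -
e^β)`. -/
theorem inv_curveFactor {j j' : ℤ} (h : j' ≠ j) :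
    (curveFactor j j')⁻¹ = (if (0 ≤ j + j' ↔ j' < j) then -expRat (posRoot (j + j')) else 1) *
      (1 - expRat (posRoot (j + j')))⁻¹ := by
  have hσ : (j' < j ∧ (j' - j).sign = -1) ∨ (j < j' ∧ (j' - j).sign = 1) := by
    rcases lt_or_gt_of_ne h with h | h
    · exact Or.inl ⟨h, Int.sign_eq_neg_one_of_neg (by omega)⟩
    · exact Or.inr ⟨h, Int.sign_eq_one_of_pos (by omega)⟩
  split_ifs with hf
  · have h1 : curveFactor j j' = 1 - expRat (-posRoot (j + j')) := by
      rw [curveFactor, posRoot]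
      congr 2
      split_ifs <;> rw [neg_lat, lat_inj] <;>
        rcases hσ with ⟨h1, h2⟩ | ⟨h1, h2⟩ <;> rw [h2] <;> omega
    have h2 := one_sub_expRat_ne_zero (posRoot_ne_zero (j + j'))
    have h3 := expRat_ne_zero (posRoot (j + j'))
    have h4 : 1 - expRat (-posRoot (j + j')) =
        (1 - expRat (posRoot (j + j'))) * (-expRat (posRoot (j + j')))⁻¹ := by
      rw [expRat_neg]; field_simp; ring
    rw [h1, h4, mul_inv, inv_inv, mul_comm]
  · rw [one_mul, curveFactor, posRoot]
    congr 3
    split_ifs <;> rw [lat_inj] <;> rcases hσ with ⟨h1, h2⟩ | ⟨h1, h2⟩ <;> rw [h2] <;> omega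

/-- The negative roots come from `-k ≤ j' < k` if `m = 2k`, and from `-k ≤ j' ≤ k` if `m = 2k + 1`.
Both ranges have `m` elements and, as `m ≤ n`, lie in the interval of `X_n`. -/
theorem prod_flipped_roots {m n : ℕ} (hmn : m ≤ n) :
    ∏ j' ∈ (Finset.Icc (low n) (high n)).erase (cosetIndex (w m)),
      (if (0 ≤ cosetIndex (w m) + j' ↔ j' < cosetIndex (w m)) then
        -expRat (posRoot (cosetIndex (w m) + j')) else 1) =
    (-1) ^ m * expRat (f (word m)) := by
  have h : (-1) ^ m * expRat (f (word m)) =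
      ∏ i ∈ Finset.range m, -expRat (lat (2 * (-1) ^ m) (i + (m % 2 : ℤ))) := by
    rw [f_word, expRat_sum, Finset.prod_neg, Finset.card_range]
  rw [← Finset.prod_filter, h]
  rcases Nat.even_or_odd' m with ⟨k, rfl | rfl⟩
  · rw [cosetIndex_w_even]
    refine Finset.prod_nbij' (fun x => (k + x).toNat) (fun i => (i : ℤ) - k) ?_ ?_ ?_ ?_ ?_
    · intro x hx; simp only [Finset.mem_filter, Finset.mem_erase, Finset.mem_Icc] at hx
      rw [Finset.mem_range]; omega
    · intro x hx; rw [Finset.mem_range] at hx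
      simp only [Finset.mem_filter, Finset.mem_erase, Finset.mem_Icc, low, high]
      omega
    · intro x hx; simp only [Finset.mem_filter, Finset.mem_erase, Finset.mem_Icc] at hx
      omega
    · intro x hx; omega
    · intro x hx; simp only [Finset.mem_filter, Finset.mem_erase, Finset.mem_Icc] at hx
      rw [posRoot, if_pos (by omega), pow_mul]
      simp only [neg_one_sq, one_pow]
      congr 3
      omega
  · rw [cosetIndex_w_odd]
    refine Finset.prod_nbij' (fun x => (k - x).toNat) (fun i => k - (i : ℤ)) ?_ ?_ ?_ ?_ ?_
    · intro x hx; simp only [Finset.mem_filter, Finset.mem_erase, Finset.mem_Icc] at hx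
      rw [Finset.mem_range]; omega
    · intro x hx; rw [Finset.mem_range] at hx
      simp only [Finset.mem_filter, Finset.mem_erase, Finset.mem_Icc, low, high]
      omega
    · intro x hx; simp only [Finset.mem_filter, Finset.mem_erase, Finset.mem_Icc] at hx
      omega
    · intro x hx; omega
    · intro x hx; simp only [Finset.mem_filter, Finset.mem_erase, Finset.mem_Icc] at hx
      rw [posRoot, if_neg (by omega), pow_succ, pow_mul]
      simp only [neg_one_sq, one_pow]
      congr 3
      omega

theorem low_le_cosetIndex_w {m n : ℕ} (hmn : m ≤ n) :
    low n ≤ cosetIndex (w m) ∧ cosetIndex (w m) ≤ high n := by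
  rcases Nat.even_or_odd' m with ⟨k, rfl | rfl⟩
  · rw [cosetIndex_w_even, low, high]; omega
  · rw [cosetIndex_w_odd, low, high]; omega

theorem schubertR_of_le {m n : ℕ} (hmn : m ≤ n) :
    schubertR m n = (-1) ^ m * expRat (f (word m)) * (1 - expRat ((w m).1 (simpleRoot 1))) *
      (qFactorial n * (qFactorial (cosetIndex (w m) - low n).toNat)⁻¹ *
        (qFactorial (high n - cosetIndex (w m)).toNat)⁻¹ *
        ∏ c ∈ Finset.Icc (low n + cosetIndex (w m)) (high n + cosetIndex (w m)),
          (1 - expRat (posRoot c))⁻¹) := by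
  obtain ⟨h1, h2⟩ := low_le_cosetIndex_w hmn
  rw [schubertR_eq]
  change schubertRat n (cosetIndex (w m)) = _
  rw [schubertRat_eq, qFactorialInv, if_neg (by omega), qFactorialInv, if_neg (by omega),
    ← prod_flipped_roots hmn, w_apply_simpleRoot_one]
  set j := cosetIndex (w m)
  have h3 : (curveProd (Finset.Icc (low n) (high n)) j)⁻¹ =
      (∏ j' ∈ (Finset.Icc (low n) (high n)).erase j,
        (if (0 ≤ j + j' ↔ j' < j) then -expRat (posRoot (j + j')) else 1)) *
      ∏ j' ∈ (Finset.Icc (low n) (high n)).erase j, (1 - expRat (posRoot (j + j')))⁻¹ := by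
    rw [curveProd, ← Finset.prod_inv_distrib, ← Finset.prod_mul_distrib]
    exact Finset.prod_congr rfl fun j' hj' => inv_curveFactor (Finset.ne_of_mem_erase hj')
  have h4 : ∏ c ∈ Finset.Icc (low n + j) (high n + j), (1 - expRat (posRoot c))⁻¹ =
      ∏ j' ∈ Finset.Icc (low n) (high n), (1 - expRat (posRoot (j + j')))⁻¹ := by
    refine Finset.prod_nbij' (fun c => c - j) (fun c => c + j) ?_ ?_ ?_ ?_ ?_ <;> intro x hx
    · simp only [Finset.mem_Icc] at hx ⊢; omega
    · simp only [Finset.mem_Icc] at hx ⊢; omega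
    · omega
    · omega
    · rw [add_sub_cancel]
  -- Restoring `j' = j` costs the factor of the root of index `2j`, which is `w_m α₁`.
  have h5 : ∏ j' ∈ (Finset.Icc (low n) (high n)).erase j, (1 - expRat (posRoot (j + j')))⁻¹ =
      (1 - expRat (posRoot (2 * j))) *
        ∏ j' ∈ Finset.Icc (low n) (high n), (1 - expRat (posRoot (j + j')))⁻¹ := by
    rw [← Finset.mul_prod_erase _ _ (Finset.mem_Icc.2 ⟨h1, h2⟩), ← two_mul,
      mul_inv_cancel_left₀ (one_sub_expRat_ne_zero (posRoot_ne_zero _))]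
  rw [h3, h4, h5]
  ring

/-- The fixed point `w_m` is then not in `X_n`. -/
theorem schubertR_of_lt {m n : ℕ} (hmn : n < m) : schubertR m n = 0 := by
  rw [schubertR_eq]
  change schubertRat n (cosetIndex (w m)) = _
  rw [schubertRat_eq]
  rcases Nat.even_or_odd' m with ⟨k, rfl | rfl⟩
  · rw [cosetIndex_w_even, qFactorialInv_of_neg (k := high n - k)]
    · simp
    · rw [high]; omega
  · rw [cosetIndex_w_odd, qFactorialInv_of_neg (k := -k - 1 - low n)]
    · simp
    · rw [low]; omega

/-! ### Power series in the exponentials of the simple roots -/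

open scoped MvPowerSeries.WithPiTopology PowerSeries.WithPiTopology

/-- The ring of power series in `e^{α₀}` and `e^{α₁}`. -/
abbrev RootSeries : Type := MvPowerSeries (Fin 2) ℤ

/-- The character `d₀ α₀ + d₁ α₁`. -/
def coneEmb : (Fin 2 →₀ ℕ) →+ CharLattice where
  toFun d := d 0 • simpleRoot 0 + d 1 • simpleRoot 1
  map_zero' := by simp
  map_add' x y := by simp only [Finsupp.add_apply, add_smul]; abel

theorem coneEmb_eq_lat (d : Fin 2 →₀ ℕ) : coneEmb d = lat (2 * d 1 - 2 * d 0) (d 0) := by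
  change d 0 • lat (-2) 1 + d 1 • lat 2 0 = _
  rw [nsmul_lat, nsmul_lat, lat_add, lat_inj]
  constructor <;> ring

theorem coneEmb_injective : Function.Injective coneEmb := fun x y h => by
  rw [coneEmb_eq_lat, coneEmb_eq_lat, lat_inj] at h
  ext i
  fin_cases i <;> simp <;> omega

theorem coneEmb_le_iff (x y : Fin 2 →₀ ℕ) : coneEmb x ≤ coneEmb y ↔ x ≤ y := by
  constructor
  · rintro ⟨p, q, h⟩
    have h' : coneEmb y = coneEmb (x + (Finsupp.single 0 p + Finsupp.single 1 q)) := by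
      rw [h, map_add, add_assoc]
      congr 1
      simp [coneEmb]
    rw [coneEmb_injective h']
    exact le_self_add
  · intro h
    obtain ⟨z, rfl⟩ := le_iff_exists_add.1 h
    exact ⟨z 0, z 1, by rw [map_add, add_assoc]; rfl⟩

/-- Power series in `e^{α₀}` and `e^{α₁}` as formal sums. -/
def rootSeriesHom : RootSeries →+* Completion :=
  (HahnSeries.embDomainRingHom coneEmb coneEmb_injective coneEmb_le_iff).comp
    (HahnSeries.toMvPowerSeries (R := ℤ) (σ := Fin 2)).symm.toRingHom

theorem coeff_rootSeriesHom (F : RootSeries) (d : Fin 2 →₀ ℕ) :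
    (rootSeriesHom F).coeff (coneEmb d) = MvPowerSeries.coeff d F := by
  refine (HahnSeries.embDomain_coeff
    (f := ⟨⟨coneEmb, coneEmb_injective⟩, coneEmb_le_iff _ _⟩)).trans ?_
  exact HahnSeries.coeff_toMvPowerSeries_symm

theorem coeff_rootSeriesHom_of_notMem (F : RootSeries) {a : CharLattice}
    (ha : a ∉ Set.range coneEmb) : (rootSeriesHom F).coeff a = 0 :=
  HahnSeries.embDomain_of_notMem_range
    (f := ⟨⟨coneEmb, coneEmb_injective⟩, coneEmb_le_iff _ _⟩) ha

theorem continuous_completion_of_coeff {Y : Type*} [TopologicalSpace Y] {g : Y → Completion}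
    (h : ∀ a, Continuous fun y => (g y).coeff a) : Continuous g := by
  have hbot : (inferInstance : TopologicalSpace ℤ) = ⊥ := DiscreteTopology.eq_bot
  refine continuous_induced_rng.2 (@continuous_pi _ _ _ _ (fun _ => ⊥) _ fun a => ?_)
  rw [← hbot]
  exact h a

theorem continuous_rootSeriesHom : Continuous rootSeriesHom := by
  refine continuous_completion_of_coeff fun a => ?_
  by_cases ha : a ∈ Set.range coneEmb
  · obtain ⟨d, rfl⟩ := ha
    simp only [coeff_rootSeriesHom]
    exact MvPowerSeries.WithPiTopology.continuous_coeff ℤ d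
  · simp only [coeff_rootSeriesHom_of_notMem _ ha]
    exact continuous_const

/-- The monomial `e^{p α₀ + q α₁}`. -/
def rootMonomial (p q : ℕ) : RootSeries :=
  MvPowerSeries.monomial (Finsupp.single 0 p + Finsupp.single 1 q) 1

theorem rootSeriesHom_rootMonomial (p q : ℕ) :
    rootSeriesHom (rootMonomial p q) = e (lat (2 * q - 2 * p) p) := by
  have h : lat (2 * q - 2 * p) p = coneEmb (Finsupp.single 0 p + Finsupp.single 1 q) := by
    rw [coneEmb_eq_lat]; simp
  rw [h]
  ext a
  by_cases ha : a ∈ Set.range coneEmb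
  · obtain ⟨d, rfl⟩ := ha
    classical
    rw [coeff_rootSeriesHom, rootMonomial, MvPowerSeries.coeff_monomial, e, HahnSeries.coeff_single]
    simp only [coneEmb_injective.eq_iff]
  · rw [coeff_rootSeriesHom_of_notMem _ ha, e, HahnSeries.coeff_single_of_ne]
    rintro rfl
    exact ha ⟨_, rfl⟩

theorem order_rootMonomial (p q : ℕ) : (rootMonomial p q).order = (p + q : ℕ) := by
  rw [rootMonomial, MvPowerSeries.order_monomial_of_ne_zero one_ne_zero]
  rw [map_add, Finsupp.degree_single, Finsupp.degree_single]

theorem constantCoeff_rootMonomial {p q : ℕ} (h : 0 < p + q) :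
    MvPowerSeries.constantCoeff (rootMonomial p q) = 0 := by
  rw [← MvPowerSeries.order_ne_zero_iff_constCoeff_eq_zero, order_rootMonomial]
  exact_mod_cast h.ne'

/-- The geometric series of a power series without constant term. -/
def geomSeries (F : RootSeries) : RootSeries := MvPowerSeries.invOfUnit (1 - F) 1

theorem geomSeries_mul {F : RootSeries} (hF : MvPowerSeries.constantCoeff F = 0) :
    geomSeries F * (1 - F) = 1 := by
  rw [mul_comm]
  exact MvPowerSeries.mul_invOfUnit _ _ (by simp [hF])

theorem geomSeries_eq {F : RootSeries} (hF : MvPowerSeries.constantCoeff F = 0) :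
    geomSeries F = 1 + F * geomSeries F := by
  linear_combination geomSeries_mul hF

/-- Only finitely many factors affect the coefficients of a given degree. -/
theorem multipliable_one_add_of_le_order {F : ℕ → RootSeries}
    (h : ∀ n : ℕ, (n : ℕ∞) ≤ (F n).order) :
    Multipliable fun n => 1 + F n := by
  refine MvPowerSeries.WithPiTopology.multipliable_one_add_of_tendsto_order_atTop_nhds_top ?_
  rw [ENat.tendsto_nhds_top_iff_natCast_lt]
  intro n
  filter_upwards [eventually_gt_atTop n] with k hk
  exact lt_of_lt_of_le (ENat.natCast_lt_natCast.2 hk) (h k)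

theorem multipliable_one_sub_rootMonomial {p q : ℕ → ℕ} (h : ∀ n, n ≤ p n + q n) :
    Multipliable fun n => 1 - rootMonomial (p n) (q n) := by
  simp only [sub_eq_add_neg]
  refine multipliable_one_add_of_le_order fun n => ?_
  rw [MvPowerSeries.order_neg, order_rootMonomial]
  exact_mod_cast h n

theorem multipliable_geomSeries {p q : ℕ → ℕ} (h : ∀ n, n ≤ p n + q n) (h0 : ∀ n, 0 < p n + q n) :
    Multipliable fun n => geomSeries (rootMonomial (p n) (q n)) := by
  have h1 : ∀ n, geomSeries (rootMonomial (p n) (q n)) =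
      1 + rootMonomial (p n) (q n) * geomSeries (rootMonomial (p n) (q n)) :=
    fun n => geomSeries_eq (constantCoeff_rootMonomial (h0 n))
  rw [funext h1]
  refine multipliable_one_add_of_le_order fun n => ?_
  refine le_trans ?_ MvPowerSeries.le_order_mul
  rw [order_rootMonomial]
  exact le_add_right (by exact_mod_cast h n)

/-! ### The imaginary roots and partitions -/

/-- The diagonal embedding of exponents. -/
def diagEmb : ℕ →+ (Fin 2 →₀ ℕ) where
  toFun n := Finsupp.single 0 n + Finsupp.single 1 n
  map_zero' := by simp
  map_add' x y := by simp only [Finsupp.single_add]; abel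

theorem diagEmb_injective : Function.Injective diagEmb := fun x y h => by
  simpa [diagEmb] using DFunLike.congr_fun h 0

theorem diagEmb_le_iff (x y : ℕ) : diagEmb x ≤ diagEmb y ↔ x ≤ y := by
  constructor
  · intro h; simpa [diagEmb] using h 0
  · intro h
    obtain ⟨z, rfl⟩ := le_iff_exists_add.1 h
    rw [map_add]
    exact le_self_add

/-- Power series in `e^δ`. -/
def deltaSeriesHom : PowerSeries ℤ →+* RootSeries :=
  ((HahnSeries.toMvPowerSeries (R := ℤ) (σ := Fin 2)).toRingHom.comp
    (HahnSeries.embDomainRingHom diagEmb diagEmb_injective diagEmb_le_iff)).comp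
    (HahnSeries.toPowerSeries (R := ℤ)).symm.toRingHom

theorem coeff_deltaSeriesHom (F : PowerSeries ℤ) (n : ℕ) :
    MvPowerSeries.coeff (diagEmb n) (deltaSeriesHom F) = PowerSeries.coeff n F := by
  refine HahnSeries.coeff_toMvPowerSeries.trans ?_
  refine (HahnSeries.embDomain_coeff
    (f := ⟨⟨diagEmb, diagEmb_injective⟩, diagEmb_le_iff _ _⟩)).trans ?_
  exact HahnSeries.coeff_toPowerSeries_symm

theorem coeff_deltaSeriesHom_of_notMem (F : PowerSeries ℤ) {d : Fin 2 →₀ ℕ}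
    (hd : d ∉ Set.range diagEmb) : MvPowerSeries.coeff d (deltaSeriesHom F) = 0 :=
  HahnSeries.coeff_toMvPowerSeries.trans <| HahnSeries.embDomain_of_notMem_range
    (f := ⟨⟨diagEmb, diagEmb_injective⟩, diagEmb_le_iff _ _⟩) hd

theorem continuous_deltaSeriesHom : Continuous deltaSeriesHom := by
  refine continuous_pi fun d => ?_
  by_cases hd : d ∈ Set.range diagEmb
  · obtain ⟨n, rfl⟩ := hd
    exact (PowerSeries.WithPiTopology.continuous_coeff ℤ n).congr
      fun F => (coeff_deltaSeriesHom F n).symm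
  · exact continuous_const.congr fun F => (coeff_deltaSeriesHom_of_notMem F hd).symm

theorem deltaSeriesHom_X_pow (n : ℕ) : deltaSeriesHom (PowerSeries.X ^ n) = rootMonomial n n := by
  classical
  ext d
  have h : rootMonomial n n = MvPowerSeries.monomial (diagEmb n) 1 := rfl
  rw [h, MvPowerSeries.coeff_monomial]
  by_cases hd : d ∈ Set.range diagEmb
  · obtain ⟨k, rfl⟩ := hd
    rw [coeff_deltaSeriesHom, PowerSeries.coeff_X_pow]
    simp only [diagEmb_injective.eq_iff]
  · rw [coeff_deltaSeriesHom_of_notMem _ hd, if_neg]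
    rintro rfl
    exact hd ⟨_, rfl⟩

/-- The generating function of the partition numbers in `e^δ`. -/
def partitionSeries : RootSeries :=
  deltaSeriesHom (PowerSeries.mk fun n => (numPartitions n : ℤ))

theorem hasSum_partitionSeries :
    HasSum (fun n : ℕ => (numPartitions n : RootSeries) * rootMonomial n n) partitionSeries := by
  have h := (PowerSeries.hasSum_of_monomials_self
    (PowerSeries.mk fun n => (numPartitions n : ℤ))).map deltaSeriesHom continuous_deltaSeriesHom
  rw [partitionSeries]
  convert h using 1
  funext n
  rw [Function.comp_apply, PowerSeries.coeff_mk, ← deltaSeriesHom_X_pow, ← map_natCast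
    deltaSeriesHom, ← map_mul]
  congr 1
  ext k
  rw [← map_natCast (PowerSeries.C (R := ℤ)), PowerSeries.coeff_C_mul_X_pow,
    PowerSeries.coeff_monomial]

/-- Euler's product for partitions without restriction, carried along `q ↦ e^δ`. -/
theorem hasProd_partitionSeries :
    HasProd (fun i : ℕ => geomSeries (rootMonomial (i + 1) (i + 1))) partitionSeries := by
  have h := (Nat.Partition.hasProd_powerSeriesMk_card_restricted ℤ (fun _ => True)).map
    deltaSeriesHom continuous_deltaSeriesHom
  convert h using 1
  · funext i
    have h1 : PowerSeries.constantCoeff ((PowerSeries.X : PowerSeries ℤ) ^ (i + 1)) = 0 := by simp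
    have h2 := congrArg deltaSeriesHom
      (PowerSeries.WithPiTopology.one_sub_mul_tsum_pow_of_constantCoeff_eq_zero h1)
    rw [map_mul, map_sub, map_one, deltaSeriesHom_X_pow] at h2
    have h3 := geomSeries_mul (constantCoeff_rootMonomial (p := i + 1) (q := i + 1) (by omega))
    simp only [Function.comp_apply, if_true, pow_mul]
    -- Both series are inverse to `1 - q^{i+1}`, hence equal.
    linear_combination (deltaSeriesHom (∑' j : ℕ, (PowerSeries.X ^ (i + 1)) ^ j)) * h3 -
      geomSeries (rootMonomial (i + 1) (i + 1)) * h2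
  · simp [partitionSeries, numPartitions, Nat.Partition.restricted]

theorem exists_hasProd_qFactorial :
    ∃ G : RootSeries, HasProd (fun i : ℕ => 1 - rootMonomial (i + 1) (i + 1)) G ∧
      G * partitionSeries = 1 := by
  obtain ⟨G, hG⟩ := multipliable_one_sub_rootMonomial (p := fun i => i + 1) (q := fun i => i + 1)
    (fun n => by omega)
  refine ⟨G, hG, ?_⟩
  refine (hG.mul hasProd_partitionSeries).unique ?_
  convert hasProd_one with i
  rw [mul_comm, geomSeries_mul (constantCoeff_rootMonomial (by omega))]

/-! ### The product over the positive real roots -/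

/-- The exponential of a positive real root as a power series. -/
def posRootMonomial (c : ℤ) : RootSeries :=
  rootMonomial c.natAbs (if 0 ≤ c then c.natAbs + 1 else c.natAbs - 1)

theorem rootSeriesHom_posRootMonomial (c : ℤ) :
    rootSeriesHom (posRootMonomial c) = e (posRoot c) := by
  rw [posRootMonomial, rootSeriesHom_rootMonomial, posRoot]
  congr 1
  split_ifs <;> rw [lat_inj] <;> omega

theorem constantCoeff_posRootMonomial (c : ℤ) :
    MvPowerSeries.constantCoeff (posRootMonomial c) = 0 :=
  constantCoeff_rootMonomial (by split_ifs <;> omega)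

/-- Each half of `ℤ` gives monomials of linearly growing degree; the two products are inverse factor
by factor. -/
theorem exists_hasProd_posRoot : ∃ D D' : RootSeries,
    HasProd (fun c => 1 - posRootMonomial c) D ∧
    HasProd (fun c => geomSeries (posRootMonomial c)) D' ∧ D * D' = 1 := by
  have h1 : Multipliable fun c => 1 - posRootMonomial c :=
    .of_nat_of_neg_add_one
      (multipliable_one_sub_rootMonomial (fun n => by split_ifs <;> omega))
      (multipliable_one_sub_rootMonomial (fun n => by split_ifs <;> omega))
  have h2 : Multipliable fun c => geomSeries (posRootMonomial c) :=
    .of_nat_of_neg_add_one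
      (multipliable_geomSeries (fun n => by split_ifs <;> omega)
        (fun n => by split_ifs <;> omega))
      (multipliable_geomSeries (fun n => by split_ifs <;> omega)
        (fun n => by split_ifs <;> omega))
  obtain ⟨D, hD⟩ := h1
  obtain ⟨D', hD'⟩ := h2
  refine ⟨D, D', hD, hD', (hD.mul hD').unique ?_⟩
  convert hasProd_one with c
  rw [mul_comm, geomSeries_mul (constantCoeff_posRootMonomial c)]

/-! ### Expansions of rational functions -/

theorem IsExpansion.algebraMap (p : CharRing) :
    IsExpansion (algebraMap CharRing RatFun p) (toCompletion p) :=
  ⟨p, 1, by simp, by simp, by simp⟩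

theorem IsExpansion.mul {r s : RatFun} {F G : Completion} (hF : IsExpansion r F)
    (hG : IsExpansion s G) : IsExpansion (r * s) (F * G) := by
  obtain ⟨p, q, hq, h1, h2⟩ := hF
  obtain ⟨p', q', hq', h1', h2'⟩ := hG
  refine ⟨p * p', q * q', ?_, ?_, ?_⟩
  · rw [map_mul]; exact hq.mul hq'
  · rw [map_mul, map_mul, ← h1, ← h1']; ring
  · rw [map_mul, map_mul, ← h2, ← h2']; ring

theorem IsExpansion.mul_rootSeriesHom {r s : RatFun} {F G : RootSeries}
    (hF : IsExpansion r (rootSeriesHom F)) (hG : IsExpansion s (rootSeriesHom G)) :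
    IsExpansion (r * s) (rootSeriesHom (F * G)) := by
  rw [map_mul]
  exact hF.mul hG

theorem IsExpansion.prod {ι : Type*} {S : Finset ι} {r : ι → RatFun} {F : ι → Completion}
    (h : ∀ i ∈ S, IsExpansion (r i) (F i)) : IsExpansion (∏ i ∈ S, r i) (∏ i ∈ S, F i) := by
  classical
  induction S using Finset.induction_on with
  | empty => simpa using IsExpansion.algebraMap 1
  | insert a S ha ih =>
    rw [Finset.prod_insert ha, Finset.prod_insert ha]
    exact (h a (Finset.mem_insert_self a S)).mul
      (ih fun i hi => h i (Finset.mem_insert_of_mem hi))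

theorem isExpansion_one_sub (a : CharLattice) : IsExpansion (1 - expRat a) (1 - e a) := by
  have h := IsExpansion.algebraMap (1 - AddMonoidAlgebra.single a 1)
  rwa [map_sub, map_sub, map_one, map_one, toCompletion_single] at h

theorem isExpansion_inv_one_sub {a : CharLattice} (ha : a ≠ 0) {F : Completion}
    (hF : F * (1 - e a) = 1) : IsExpansion (1 - expRat a)⁻¹ F := by
  refine ⟨1, 1 - AddMonoidAlgebra.single a 1, ?_, ?_, ?_⟩
  · rw [map_sub, map_one, toCompletion_single]
    exact IsUnit.of_mul_eq_one_right _ hF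
  · rw [map_sub, map_one]
    exact inv_mul_cancel₀ (one_sub_expRat_ne_zero ha)
  · rw [map_sub, map_one, toCompletion_single, hF]

theorem isExpansion_qFactorial (n : ℕ) : IsExpansion (qFactorial n)
    (rootSeriesHom (∏ i ∈ Finset.range n, (1 - rootMonomial (i + 1) (i + 1)))) := by
  rw [map_prod]
  refine IsExpansion.prod fun i _ => ?_
  rw [map_sub, map_one, rootSeriesHom_rootMonomial, sub_self, Nat.cast_succ]
  exact isExpansion_one_sub _

theorem isExpansion_inv_qFactorial (n : ℕ) : IsExpansion (qFactorial n)⁻¹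
    (rootSeriesHom (∏ i ∈ Finset.range n, geomSeries (rootMonomial (i + 1) (i + 1)))) := by
  rw [map_prod, qFactorial, ← Finset.prod_inv_distrib]
  refine IsExpansion.prod fun i _ => isExpansion_inv_one_sub ?_ ?_
  · rw [zero_eq_lat, Ne, lat_inj]; omega
  · have h : e (lat 0 (i + 1)) = rootSeriesHom (rootMonomial (i + 1) (i + 1)) := by
      rw [rootSeriesHom_rootMonomial, sub_self, Nat.cast_succ]
    rw [h, ← map_one rootSeriesHom, ← map_sub, ← map_mul,
      geomSeries_mul (constantCoeff_rootMonomial (by omega))]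

theorem isExpansion_inv_one_sub_posRoot (c : ℤ) : IsExpansion (1 - expRat (posRoot c))⁻¹
    (rootSeriesHom (geomSeries (posRootMonomial c))) := by
  refine isExpansion_inv_one_sub (posRoot_ne_zero c) ?_
  rw [← rootSeriesHom_posRootMonomial, ← map_one rootSeriesHom, ← map_sub, ← map_mul,
    geomSeries_mul (constantCoeff_posRootMonomial c)]

/-- Since `f(w_m)` is a sum of positive real roots, its exponential is a product of root monomials.
-/
theorem exists_rootSeriesHom_eq_f (m : ℕ) :
    ∃ F : RootSeries, rootSeriesHom F = e (f (word m)) := by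
  have hsum : ∀ (S : Finset ℕ) (g : ℕ → CharLattice), e (∑ i ∈ S, g i) = ∏ i ∈ S, e (g i) := by
    intro S g
    induction S using Finset.induction_on with
    | empty => rfl
    | insert a S ha ih =>
      rw [Finset.sum_insert ha, Finset.prod_insert ha, ← ih, e, e, e, HahnSeries.single_mul_single,
        one_mul]
  refine ⟨∏ i ∈ Finset.range m, posRootMonomial ((-1) ^ m * (i + (m % 2 : ℤ))), ?_⟩
  rw [f_word, hsum, map_prod]
  refine Finset.prod_congr rfl fun i _ => ?_
  rw [rootSeriesHom_posRootMonomial, posRoot]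
  congr 1
  rcases Nat.even_or_odd' m with ⟨k, rfl | rfl⟩
  · simp only [pow_mul, neg_one_sq, one_pow]
    rw [if_pos (by omega), lat_inj]; omega
  · simp only [pow_succ _ (2 * k), pow_mul, neg_one_sq, one_pow]
    rw [if_neg (by omega), lat_inj]; omega

/-! ### Positive real roots -/

theorem mem_posRealRoots_iff (a : CharLattice) : a ∈ posRealRoots ↔ ∃ c, posRoot c = a := by
  have h1 : simpleRoot 1 = lat 2 0 := rfl
  simp only [posRealRoots, Set.mem_union, Set.mem_singleton_iff, Set.mem_ofPred_eq, delta_eq_lat,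
    nsmul_lat, h1, neg_lat, lat_add]
  constructor
  · rintro (rfl | ⟨n, hn, rfl | rfl⟩)
    · exact ⟨0, rfl⟩
    · exact ⟨n, by rw [posRoot, if_pos (by omega), lat_inj]; omega⟩
    · exact ⟨-n, by rw [posRoot, if_neg (by omega), lat_inj]; omega⟩
  · rintro ⟨c, rfl⟩
    rw [posRoot]
    split_ifs with hc
    · rcases hc.eq_or_lt with rfl | hc
      · exact Or.inl rfl
      · exact Or.inr ⟨c.toNat, by omega, Or.inl (by rw [lat_inj]; omega)⟩
    · exact Or.inr ⟨(-c).toNat, by omega, Or.inr (by rw [lat_inj]; omega)⟩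

theorem posRoot_injective : Function.Injective posRoot := fun x y h => by
  rw [posRoot, posRoot] at h
  split_ifs at h <;> rw [lat_inj] at h <;> omega

/-- The enumeration of the positive real roots by integers. -/
def posRootEquiv : ℤ ≃ posRealRoots :=
  Equiv.ofBijective (fun c => ⟨posRoot c, (mem_posRealRoots_iff _).2 ⟨c, rfl⟩⟩)
    ⟨fun _ _ h => posRoot_injective (Subtype.ext_iff.1 h), fun ⟨a, ha⟩ => by
      obtain ⟨c, rfl⟩ := (mem_posRealRoots_iff a).1 ha
      exact ⟨c, rfl⟩⟩

theorem hasProd_posRealRoots {D : RootSeries} (hD : HasProd (fun c => 1 - posRootMonomial c) D) :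
    HasProd (fun a : posRealRoots => 1 - e a) (rootSeriesHom D) := by
  rw [← posRootEquiv.hasProd_iff]
  convert hD.map rootSeriesHom continuous_rootSeriesHom using 1
  funext c
  rw [Function.comp_apply, Function.comp_apply, map_sub, map_one, rootSeriesHom_posRootMonomial]
  rfl

/-! ### The limit -/

theorem tendsto_Icc_low_high (j : ℤ) :
    Tendsto (fun n => Finset.Icc (low n + j) (high n + j)) atTop atTop := by
  refine tendsto_atTop_finset_of_monotone ?_ ?_
  · intro a b hab
    refine Finset.Icc_subset_Icc ?_ ?_ <;> simp only [low, high] <;> omega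
  · intro x
    refine ⟨2 * (x - j).natAbs + 1, ?_⟩
    simp only [Finset.mem_Icc, low, high]
    omega

theorem exists_isLocalizationFunction (m : ℕ) {F D' : RootSeries}
    (hF : rootSeriesHom F = e (f (word m)))
    (hD' : HasProd (fun c => geomSeries (posRootMonomial c)) D') :
    IsLocalizationFunction m (rootSeriesHom ((-1) ^ m * F *
      (1 - posRootMonomial (2 * cosetIndex (w m))) * (partitionSeries * D'))) := by
  obtain ⟨G, hG, hGP⟩ := exists_hasProd_qFactorial
  set j := cosetIndex (w m) with hj
  set E : ℕ → RootSeries := fun n => (-1) ^ m * F * (1 - posRootMonomial (2 * j)) *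
    ((∏ i ∈ Finset.range n, (1 - rootMonomial (i + 1) (i + 1))) *
      (∏ i ∈ Finset.range (j - low n).toNat, geomSeries (rootMonomial (i + 1) (i + 1))) *
      (∏ i ∈ Finset.range (high n - j).toNat, geomSeries (rootMonomial (i + 1) (i + 1))) *
      ∏ c ∈ Finset.Icc (low n + j) (high n + j), geomSeries (posRootMonomial c)) with hE
  refine ⟨fun n => if m ≤ n then rootSeriesHom (E n) else 0, fun n => ?_, ?_⟩
  · dsimp only
    split_ifs with hmn
    · rw [schubertR_of_le hmn, hE]
      dsimp only
      refine .mul_rootSeriesHom ?_ (.mul_rootSeriesHom (.mul_rootSeriesHom (.mul_rootSeriesHom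
        (isExpansion_qFactorial n) (isExpansion_inv_qFactorial _)) (isExpansion_inv_qFactorial _))
        ?_)
      swap
      · rw [map_prod]
        exact .prod fun c _ => isExpansion_inv_one_sub_posRoot c
      have h := IsExpansion.algebraMap ((-1) ^ m * AddMonoidAlgebra.single (f (word m)) 1 *
        (1 - AddMonoidAlgebra.single ((w m).1 (simpleRoot 1)) 1))
      simp only [map_mul, map_pow, map_neg, map_one, map_sub, toCompletion_single, hF,
        rootSeriesHom_posRootMonomial, ← w_apply_simpleRoot_one, hj] at h ⊢
      exact h
    · rw [schubertR_of_lt (not_le.1 hmn)]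
      simpa using IsExpansion.algebraMap 0
  · refine Tendsto.congr' (f₁ := fun n => rootSeriesHom (E n)) ?_ ?_
    · filter_upwards [eventually_ge_atTop m] with n hn
      rw [if_pos hn]
    · refine (continuous_rootSeriesHom.tendsto _).comp ?_
      have hP := hasProd_partitionSeries.tendsto_prod_nat
      have hu : Tendsto (fun n => (j - low n).toNat) atTop atTop :=
        tendsto_atTop_atTop.2 fun b => ⟨2 * (b + j.natAbs), fun n hn => by
          simp only [low]; omega⟩
      have hv : Tendsto (fun n => (high n - j).toNat) atTop atTop :=
        tendsto_atTop_atTop.2 fun b => ⟨2 * (b + j.natAbs), fun n hn => by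
          simp only [high]; omega⟩
      have hlim := ((hG.tendsto_prod_nat.mul (hP.comp hu)).mul (hP.comp hv)).mul
        (Tendsto.comp hD' (tendsto_Icc_low_high j))
      -- The limit of `[n]!` cancels one of the two partition series coming from the denominators.
      rw [hGP, one_mul] at hlim
      exact tendsto_const_nhds.mul hlim

theorem hasSum_numPartitions :
    HasSum (fun n : ℕ => (numPartitions n : Completion) * e (n • delta))
      (rootSeriesHom partitionSeries) := by
  have h := hasSum_partitionSeries.map rootSeriesHom continuous_rootSeriesHom
  convert h using 1
  funext n
  rw [Function.comp_apply, map_mul, map_natCast, rootSeriesHom_rootMonomial, delta_eq_lat,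
    nsmul_lat, sub_self, mul_zero, mul_one]

end

end AffineSL2

theorem theorem7p1 (m : ℕ) :
    ∃ R : AffineSL2.Completion,
      AffineSL2.IsLocalizationFunction m R ∧
      Summable (fun n : ℕ =>
        (AffineSL2.numPartitions n : AffineSL2.Completion) * AffineSL2.e (n • AffineSL2.delta)) ∧
      Multipliable (fun a : AffineSL2.posRealRoots => 1 - AffineSL2.e a) ∧
      IsUnit (∏' a : AffineSL2.posRealRoots, (1 - AffineSL2.e a)) ∧
      R = (-1) ^ m * AffineSL2.e (AffineSL2.f (AffineSL2.word m)) *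
        (1 - AffineSL2.e ((AffineSL2.w m).1 (AffineSL2.simpleRoot 1))) *
        (∑' n : ℕ,
          (AffineSL2.numPartitions n : AffineSL2.Completion) * AffineSL2.e (n • AffineSL2.delta)) *
        Ring.inverse (∏' a : AffineSL2.posRealRoots, (1 - AffineSL2.e a)) := by
  obtain ⟨D, D', hD, hD', hDD'⟩ := AffineSL2.exists_hasProd_posRoot
  obtain ⟨F, hF⟩ := AffineSL2.exists_rootSeriesHom_eq_f m
  have hprod := AffineSL2.hasProd_posRealRoots hD
  have hsum := AffineSL2.hasSum_numPartitions
  have hinv : AffineSL2.rootSeriesHom D * AffineSL2.rootSeriesHom D' = 1 := by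
    rw [← map_mul, hDD', map_one]
  have hunit : IsUnit (AffineSL2.rootSeriesHom D) := .of_mul_eq_one _ hinv
  have hinv' : Ring.inverse (AffineSL2.rootSeriesHom D) = AffineSL2.rootSeriesHom D' := by
    rw [← mul_one (Ring.inverse _), ← hinv, Ring.inverse_mul_cancel_left _ _ hunit]
  refine ⟨_, AffineSL2.exists_isLocalizationFunction m hF hD', hsum.summable, hprod.multipliable,
    ?_, ?_⟩
  · rwa [hprod.tprod_eq]
  · rw [hprod.tprod_eq, hsum.tsum_eq, hinv']
    simp only [map_mul, map_pow, map_neg, map_one, map_sub, hF,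
      AffineSL2.rootSeriesHom_posRootMonomial, ← AffineSL2.w_apply_simpleRoot_one, mul_assoc]
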